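/- **Theorem 1.1.** For oriented link diagrams $D, D'$ in the plane $\mathbb R^2$ let $\Omega_3(D,D')$ denote the minimal number of type III moves in a finite sequence of planar isotopies and (oriented, in all variants) Reidemeister moves of types I, II and III that transforms $D$ into $D'$; moving an arc through the point at infinity is not allowed. Consider the following oriented diagrams, each determined up to planar isotopy. * $D_1$ and $D_2$ are diagrams of the trefoil knot. Take a row of three positive crossings in which both strands run upwards. In $D_2$ both strands are closed up by parallel arcs on the left side of the row; so $D_2$ is the closed 2-braid with three positive crossings running counterclockwise, and its unbounded region is a 3-gon. In $D_1$ one strand is closed up by an arc on the left side of the row and the other strand by an arc on the right side; the unbounded region of $D_1$ is a bigon. * $D_3$ and $D_4$ are diagrams of the figure-eight knot with four crossings $A,B,C,D$, where $A,B$ are negative and $C,D$ are positive. Along the oriented knot the crossings are met in the cyclic order $$A^-\;C^+\;D^-\;A^+\;B^-\;D^+\;C^-\;B^+ ,$$ where the superscript $+$ (respectively $-$) means that the crossing is passed as over-crossing (respectively under-crossing). This determines the diagram on the 2-sphere; its regions are two bigons and four triangles. In $D_3$ the unbounded region is the triangle with vertices $A,B,D$, and in $D_4$ it is the triangle with vertices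 $A,C,D$. * $D_5$ and $D_6$ are the diagrams of the $(2,4)$-torus link, with parallel orientations, constructed like $D_1$ and $D_2$ respectively from a row of four positive crossings. On the 2-sphere, $D_{2i-1}$ becomes $D_{2i}$ $(i=1,2,3)$ by throwing one outermost arc through infinity. Then 1. $\Omega_3(D_1,D_2)=2$, 2. $\Omega_3(D_3,D_4)=3$, 3. $\Omega_3(D_5,D_6)=3$. -/

import Mathlib

/-!
# Oriented link diagrams in the plane, Reidemeister moves, and the type III count

An oriented link diagram in the plane is, after a planar isotopy, in general position with
respect to the height function: every horizontal line contains at most one critical point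
(a local minimum, a local maximum) or crossing, and at the crossings both strands are
transverse to the horizontal direction.  Read from the bottom to the top it is then a finite
sequence of elementary layers, each made of vertical strands and exactly one cup, cap or crossing.
Such sequences are the diagrams below.  All oriented link diagrams are covered (any number
of components, split diagrams, crossingless circles, the empty diagram), and the unbounded
region of the plane is the region to the left (and right) of all strands.  No passage through
the point at infinity of the sphere is available.

Two diagrams in general position are planar isotopic iff they are related by a finite sequence
of the following local changes, which are the generic events in a one-parameter family of plane
curves: two horizontally disjoint elementary pieces exchange their heights, a local minimum and a
local maximum on the same strand are created or cancelled, a local extremum of one strand passes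
through a crossing with another strand.
-/

namespace PlaneDiagram

/-- An elementary piece of an oriented diagram.  A strand meeting a horizontal line is recorded
by a Boolean: `true` if it is oriented upwards there, `false` if it is oriented downwards.

* `cup o` is a local minimum; its left end has direction `o`, its right end direction `!o`.
* `cap o` is a local maximum; its left end has direction `o`, its right end direction `!o`.
* `cross b o₁ o₂` is a crossing of a strand of direction `o₁` that runs from the bottom left to
  the top right and a strand of direction `o₂` that runs from the bottom right to the top left
  (positions as pictured, whatever the orientations are).  The first of the two is the over-strand
  if `b = true`, and the second one is the over-strand if `b = false`. -/
inductive Piece where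
  | cup (o : Bool)
  | cap (o : Bool)
  | cross (b o₁ o₂ : Bool)

/-- The strands at the bottom of an elementary piece, from left to right. -/
def Piece.bot : Piece → List Bool
  | .cup _ => []
  | .cap o => [o, !o]
  | .cross _ o₁ o₂ => [o₁, o₂]

/-- The strands at the top of an elementary piece, from left to right. -/
def Piece.top : Piece → List Bool
  | .cup o => [o, !o]
  | .cap _ => []
  | .cross _ o₁ o₂ => [o₂, o₁]

/-- A horizontal layer: one elementary piece, with the vertical strands `left` on its left side
and the vertical strands `right` on its right side. -/
structure Layer where
  left : List Bool
  piece : Piece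
  right : List Bool

/-- The strands at the bottom of a layer. -/
def Layer.bot (L : Layer) : List Bool := L.left ++ L.piece.bot ++ L.right

/-- The strands at the top of a layer. -/
def Layer.top (L : Layer) : List Bool := L.left ++ L.piece.top ++ L.right

/-- Place the vertical strands `l` to the left of a layer and `r` to the right of it. -/
def Layer.widen (l r : List Bool) (L : Layer) : Layer :=
  ⟨l ++ L.left, L.piece, L.right ++ r⟩

/-- `IsTangle a T b`: the layers `T`, listed from the bottom to the top, fit together to an
oriented tangle diagram with strands `a` at the bottom and strands `b` at the top. -/
def IsTangle : List Bool → List Layer → List Bool → Prop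
  | a, [], b => a = b
  | a, L :: T, b => a = L.bot ∧ IsTangle L.top T b

/-- An oriented link diagram in the plane. -/
structure Diagram where
  layers : List Layer
  closed : IsTangle [] layers []

/-- The kinds of moves between diagrams. -/
inductive MoveKind where
  | isotopy
  | typeI
  | typeII
  | typeIII
  deriving DecidableEq

/-- The local pictures of the moves: `Local k T T'` says that the small tangle diagrams `T` and
`T'` (with the same ends) are the two sides of a move of kind `k`. -/
inductive Local : MoveKind → List Layer → List Layer → Prop
  /-- Planar isotopy: a piece `p` and a piece `q` to the right of it, with the vertical strands `m`
  between them, exchange their heights. -/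
  | exchange (p q : Piece) (m : List Bool) :
      Local .isotopy
        [⟨[], p, m ++ q.bot⟩, ⟨p.top ++ m, q, []⟩]
        [⟨p.bot ++ m, q, []⟩, ⟨[], p, m ++ q.top⟩]
  /-- Planar isotopy: a minimum and the maximum to the left of it cancel. -/
  | zigzagLeft (o : Bool) :
      Local .isotopy
        [⟨[o], .cup (!o), []⟩, ⟨[], .cap o, [o]⟩]
        []
  /-- Planar isotopy: a minimum and the maximum to the right of it cancel. -/
  | zigzagRight (o : Bool) :
      Local .isotopy
        [⟨[], .cup o, [o]⟩, ⟨[o], .cap (!o), []⟩]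
        []
  /-- Planar isotopy: the maximum of one strand passes through its crossing with a strand of
  direction `s`, so that the crossing moves from the right to the left leg of the maximum. -/
  | slideCap (b u s : Bool) :
      Local .isotopy
        [⟨[u], .cross b s (!u), []⟩, ⟨[], .cap u, [s]⟩]
        [⟨[], .cross (!b) u s, [!u]⟩, ⟨[s], .cap u, []⟩]
  /-- Planar isotopy: the minimum of one strand passes through its crossing with a strand of
  direction `s`, so that the crossing moves from the left to the right leg of the minimum. -/
  | slideCup (b u s : Bool) :
      Local .isotopy
        [⟨[s], .cup u, []⟩, ⟨[], .cross b s u, [!u]⟩]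
        [⟨[], .cup u, [s]⟩, ⟨[u], .cross (!b) (!u) s, []⟩]
  /-- Type I: a kink with its loop on the right side of a vertical strand is removed. -/
  | kinkRight (b o : Bool) :
      Local .typeI
        [⟨[o], .cup o, []⟩, ⟨[], .cross b o o, [!o]⟩, ⟨[o], .cap o, []⟩]
        []
  /-- Type I: a kink with its loop on the left side of a vertical strand is removed. -/
  | kinkLeft (b o : Bool) :
      Local .typeI
        [⟨[], .cup (!o), [o]⟩, ⟨[!o], .cross b o o, []⟩, ⟨[], .cap (!o), [o]⟩]
        []
  /-- Type II: two strands that cross twice, with the same strand over at both crossings, are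
  pulled apart. -/
  | bigon (b o₁ o₂ : Bool) :
      Local .typeII
        [⟨[], .cross b o₁ o₂, []⟩, ⟨[], .cross (!b) o₂ o₁, []⟩]
        []
  /-- Type III: three strands cross pairwise, and one strand is moved across the crossing of the
  other two.  The strands are numbered from left to right at the bottom; `b₁₂`, `b₁₃`, `b₂₃` tell
  whether the strand with the smaller number is the over-strand at the crossing of the two.  The
  hypothesis says that one strand is the top, one the middle and one the bottom strand
  (the over-under relation between the three strands is not cyclic). -/
  | triangle (b₁₂ b₁₃ b₂₃ o₁ o₂ o₃ : Bool) (h : b₁₂ = b₂₃ → b₁₃ = b₁₂) :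
      Local .typeIII
        [⟨[], .cross b₁₂ o₁ o₂, [o₃]⟩, ⟨[o₂], .cross b₁₃ o₁ o₃, []⟩,
          ⟨[], .cross b₂₃ o₂ o₃, [o₁]⟩]
        [⟨[o₁], .cross b₂₃ o₂ o₃, []⟩, ⟨[], .cross b₁₃ o₁ o₃, [o₂]⟩,
          ⟨[o₃], .cross b₁₂ o₁ o₂, []⟩]

/-- `Move k D D'`: the diagram `D'` is obtained from `D` by one move of kind `k` (in either
direction of the local picture), performed inside a disc outside of which `D` and `D'` agree. -/
def Move (k : MoveKind) (D D' : Diagram) : Prop :=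
  ∃ (A B : List Layer) (l r : List Bool) (T T' : List Layer),
    (Local k T T' ∨ Local k T' T) ∧
    D.layers = A ++ T.map (Layer.widen l r) ++ B ∧
    D'.layers = A ++ T'.map (Layer.widen l r) ++ B

/-- `Connects m D D'`: there is a finite sequence of planar isotopies and Reidemeister moves from
`D` to `D'` that contains exactly `m` moves of type III. -/
inductive Connects : ℕ → Diagram → Diagram → Prop
  | refl (D : Diagram) : Connects 0 D D
  | step {m : ℕ} {D D' D'' : Diagram} (k : MoveKind) :
      Connects m D D' → Move k D' D'' →
      Connects (m + if k = .typeIII then 1 else 0) D D''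

/-- `Ω₃(D, D')`, the minimal number of type III moves in a sequence of planar isotopies and
Reidemeister moves from `D` to `D'` (`⊤` if there is no such sequence). -/
noncomputable def Omega3 (D D' : Diagram) : ℕ∞ :=
  ⨅ (m : ℕ) (_ : Connects m D D'), (m : ℕ∞)

/-- The trefoil diagram `D₁`: three positive crossings in a vertical row, both strands running
upwards through the row, one of them closed up on the left side of the row and the other one on
the right side.  The unbounded region is a bigon. -/
def D₁ : Diagram where
  layers :=
    [⟨[], .cup true, []⟩, ⟨[], .cup false, [true, false]⟩,
      ⟨[false], .cross true true true, [false]⟩,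
      ⟨[false], .cross true true true, [false]⟩,
      ⟨[false], .cross true true true, [false]⟩,
      ⟨[], .cap false, [true, false]⟩, ⟨[], .cap true, []⟩]
  closed := by simp [IsTangle, Layer.bot, Layer.top, Piece.bot, Piece.top]

/-- The trefoil diagram `D₂`: the same row of three positive crossings with both strands
closed up on its left side, that is, the closed 2-braid with three positive crossings that runs
counterclockwise.  It arises from `D₁` by throwing the outermost arc on the right through
infinity to the left. -/
def D₂ : Diagram where
  layers :=
    [⟨[], .cup false, []⟩, ⟨[false], .cup false, [true]⟩,
      ⟨[false, false], .cross true true true, []⟩,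
      ⟨[false, false], .cross true true true, []⟩,
      ⟨[false, false], .cross true true true, []⟩,
      ⟨[false], .cap false, [true]⟩, ⟨[], .cap false, []⟩]
  closed := by simp [IsTangle, Layer.bot, Layer.top, Piece.bot, Piece.top]

/-- The figure-eight diagram `D₃`: a long figure-eight knot with four crossings (two positive and
two negative ones) that runs downwards, closed up by an arc on its left side. -/
def D₃ : Diagram where
  layers :=
    [⟨[], .cup true, []⟩, ⟨[true], .cup true, [false]⟩,
      ⟨[true, true], .cross true false false, []⟩,
      ⟨[true], .cross false true false, [false]⟩,
      ⟨[true, false], .cross true true false, []⟩,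
      ⟨[true, false], .cross true false true, []⟩,
      ⟨[true], .cap false, [false]⟩, ⟨[], .cap true, []⟩]
  closed := by simp [IsTangle, Layer.bot, Layer.top, Piece.bot, Piece.top]

/-- The figure-eight diagram `D₄`: the same long figure-eight knot as in `D₃`, closed up by an arc
on its right side.  It arises from `D₃` by throwing the outermost arc through infinity. -/
def D₄ : Diagram where
  layers :=
    [⟨[], .cup false, []⟩, ⟨[], .cup true, [false, true]⟩,
      ⟨[true], .cross true false false, [true]⟩,
      ⟨[], .cross false true false, [false, true]⟩,
      ⟨[false], .cross true true false, [true]⟩,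
      ⟨[false], .cross true false true, [true]⟩,
      ⟨[], .cap false, [false, true]⟩, ⟨[], .cap false, []⟩]
  closed := by simp [IsTangle, Layer.bot, Layer.top, Piece.bot, Piece.top]

/-- The (2,4)-torus link diagram `D₅`: four positive crossings in a vertical row, both strands
running upwards through the row, one of them closed up on the left side of the row and the other
one on the right side.  The unbounded region is a bigon. -/
def D₅ : Diagram where
  layers :=
    [⟨[], .cup true, []⟩, ⟨[], .cup false, [true, false]⟩,
      ⟨[false], .cross true true true, [false]⟩,
      ⟨[false], .cross true true true, [false]⟩,
      ⟨[false], .cross true true true, [false]⟩,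
      ⟨[false], .cross true true true, [false]⟩,
      ⟨[], .cap false, [true, false]⟩, ⟨[], .cap true, []⟩]
  closed := by simp [IsTangle, Layer.bot, Layer.top, Piece.bot, Piece.top]

/-- The (2,4)-torus link diagram `D₆`: the closed 2-braid with four positive crossings that runs
counterclockwise.  It arises from `D₅` by throwing the outermost arc on the right through
infinity to the left. -/
def D₆ : Diagram where
  layers :=
    [⟨[], .cup false, []⟩, ⟨[false], .cup false, [true]⟩,
      ⟨[false, false], .cross true true true, []⟩,
      ⟨[false, false], .cross true true true, []⟩,
      ⟨[false, false], .cross true true true, []⟩,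
      ⟨[false, false], .cross true true true, []⟩,
      ⟨[false], .cap false, [true]⟩, ⟨[], .cap false, []⟩]
  closed := by simp [IsTangle, Layer.bot, Layer.top, Piece.bot, Piece.top]

end PlaneDiagram

namespace PlaneDiagram

/-! ### Colourings of strands and regions -/

/-! Lower bounds. Colour the strands by the dihedral quandle modulo `n` (an under-strand is
reflected in the over-strand), extend this to the regions, with a checkerboard parity added, and fix
the colour of the unbounded region. A function `θ` of the colours at a crossing gives each colouring
a weight, the signed sum over all crossings. A shadow quandle cocycle `θ` would make this weight
invariant under all moves; here the coboundary of `θ` is only required to be bounded by `B`. Type I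
moves do not matter because `θ` vanishes on equal colours, type II moves because the two crossings
cancel, and planar isotopies because a rotated crossing contributes the same. A type III move
changes the weight by a value of the coboundary up to sign, so by at most `B`
(`Weight.Bounded.triangle`). Colourings can therefore be followed along any sequence of moves, and
`m` moves of type III shift the weight by at most `m * B` (`Connects.hasWeight`). A colouring of `D`
whose weight is at least `m * B` above every weight of `D'` thus forces `m` such moves
(`le_omega3`).

Planarity enters through the fixed colour outside: throwing an arc through infinity changes the
colour of the unbounded region, so two diagrams that agree on the sphere can have different weights.
The moduli 3, 5, 4 are the determinants of the trefoil, the figure-eight knot and the (2,4)-torus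
link, so nonconstant colourings exist; constant ones have weight 0. For suitable `θ`, everything
left is a finite check.

Upper bounds. The outermost arc is swung over the whole diagram. Since it ends at the top crossing,
it can be brought in just below that crossing by moves of types I and II alone; each of the
remaining 2, 3, 3 crossings then costs one type III move. -/

/-- A colour of a region: a colour modulo `n` and a checkerboard parity. -/
abbrev Region (n : ℕ) := ZMod n × Bool

/-- The colour of the region on the other side of a strand of colour `c`. -/
def Region.across {n : ℕ} (y : Region n) (c : ZMod n) : Region n := (2 * c - y.1, !y.2)

/-- A weight of crossings, depending on the colour of the source region, on the colour of the
under-strand next to it, and on the colour of the over-strand. -/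
abbrev Weight (n : ℕ) := Region n → ZMod n → ZMod n → ℤ

/-- The colour at the top left of a crossing with colours `c₁`, `c₂` at the bottom. -/
def topLeft {n : ℕ} (b : Bool) (c₁ c₂ : ZMod n) : ZMod n := if b then 2 * c₁ - c₂ else c₂

/-- The colour at the top right of a crossing with colours `c₁`, `c₂` at the bottom. -/
def topRight {n : ℕ} (b : Bool) (c₁ c₂ : ZMod n) : ZMod n := if b then c₁ else 2 * c₂ - c₁

/-- The source region of a crossing: the one that both strands leave on their left side. -/
def source {n : ℕ} (b o₁ o₂ : Bool) (y : Region n) (c₁ c₂ : ZMod n) : Region n :=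
  match o₁, o₂ with
  | true, true => y
  | true, false => y.across (topLeft b c₁ c₂)
  | false, true => y.across c₁
  | false, false => (y.across c₁).across c₂

/-- The contribution of a crossing with the region `y` on its left and the colours `c₁`, `c₂` at
its bottom. -/
def Weight.crossing {n : ℕ} (θ : Weight n) (b o₁ o₂ : Bool) (y : Region n) (c₁ c₂ : ZMod n) : ℤ :=
  (if b = (o₁ == o₂) then 1 else -1) *
    θ (source b o₁ o₂ y c₁ c₂)
      (if b then (if o₁ then topLeft b c₁ c₂ else c₂) else (if o₂ then c₁ else topRight b c₁ c₂))
      (if b then c₁ else c₂)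

/-- The colourings of an elementary piece with the region `y` on its left: the colours at the
bottom, the weight, and the colours at the top. -/
inductive PieceColoring {n : ℕ} (θ : Weight n) (y : Region n) :
    Piece → List (ZMod n) → ℤ → List (ZMod n) → Prop
  | cup (o : Bool) (c : ZMod n) : PieceColoring θ y (.cup o) [] 0 [c, c]
  | cap (o : Bool) (c : ZMod n) : PieceColoring θ y (.cap o) [c, c] 0 []
  | cross (b o₁ o₂ : Bool) (c₁ c₂ : ZMod n) :
      PieceColoring θ y (.cross b o₁ o₂) [c₁, c₂] (θ.crossing b o₁ o₂ y c₁ c₂)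
        [topLeft b c₁ c₂, topRight b c₁ c₂]

/-- The region to the right of strands with colours `x`, where `y` is the region to their left. -/
def Region.past {n : ℕ} (y : Region n) (x : List (ZMod n)) : Region n := x.foldl Region.across y

/-- The colourings of a layer. -/
def LayerColoring {n : ℕ} (θ : Weight n) (L : Layer) (y : Region n) (x : List (ZMod n)) (w : ℤ)
    (x' : List (ZMod n)) : Prop :=
  ∃ l p p' r, l.length = L.left.length ∧ r.length = L.right.length ∧
    x = l ++ p ++ r ∧ x' = l ++ p' ++ r ∧ PieceColoring θ (y.past l) L.piece p w p'

/-- The colourings of a tangle diagram with the region `y` on its left, with their total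
weight. -/
def Coloring {n : ℕ} (θ : Weight n) (y : Region n) :
    List Layer → List (ZMod n) → ℤ → List (ZMod n) → Prop
  | [], x, w, x' => x = x' ∧ w = 0
  | L :: T, x, w, x' => ∃ w₁ w₂ z, LayerColoring θ L y x w₁ z ∧ Coloring θ y T z w₂ x' ∧ w = w₁ + w₂

variable {n : ℕ} {θ : Weight n}

@[simp] lemma Region.past_nil (y : Region n) : y.past [] = y := rfl

@[simp] lemma Region.past_cons (y : Region n) (c : ZMod n) (x : List (ZMod n)) :
    y.past (c :: x) = (y.across c).past x := rfl

@[simp] lemma Region.past_append (y : Region n) (x x' : List (ZMod n)) :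
    y.past (x ++ x') = (y.past x).past x' := List.foldl_append

@[simp] lemma Region.across_across (y : Region n) (c : ZMod n) : (y.across c).across c = y := by
  ext <;> simp [Region.across]

lemma PieceColoring.length_bot {y : Region n} {p : Piece} {u u' : List (ZMod n)} {w : ℤ}
    (h : PieceColoring θ y p u w u') : u.length = p.bot.length := by
  cases h <;> rfl

lemma PieceColoring.length_top {y : Region n} {p : Piece} {u u' : List (ZMod n)} {w : ℤ}
    (h : PieceColoring θ y p u w u') : u'.length = p.top.length := by
  cases h <;> rfl

/-- Region colours are consistent around a crossing: the reflections in the two bottom colours and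
those in the two top colours have the same composite. -/
lemma PieceColoring.past_eq {y : Region n} {p : Piece} {u u' : List (ZMod n)} {w : ℤ}
    (h : PieceColoring θ y p u w u') : y.past u' = y.past u := by
  cases h with
  | cup | cap => simp
  | cross b => cases b <;> ext <;> simp [Region.across, topLeft, topRight] <;> ring

lemma LayerColoring.length_top {L : Layer} {y : Region n} {x x' : List (ZMod n)} {w : ℤ}
    (h : LayerColoring θ L y x w x') : x'.length = L.top.length := by
  obtain ⟨l, p, p', r, hl, hr, rfl, rfl, hp⟩ := h
  simp [Layer.top, hl, hr, hp.length_top]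

lemma Coloring.length_top {y : Region n} {T : List Layer} {a b : List Bool}
    {x x' : List (ZMod n)} {w : ℤ} (hT : IsTangle a T b) (h : Coloring θ y T x w x')
    (hx : x.length = a.length) : x'.length = b.length := by
  induction T generalizing a x w with
  | nil => obtain ⟨rfl, -⟩ := h; rw [hx, show a = b from hT]
  | cons L T ih =>
    obtain ⟨w₁, w₂, z, h₁, h₂, -⟩ := h
    exact ih hT.2 h₂ h₁.length_top

lemma coloring_append {y : Region n} {A B : List Layer} {x x' : List (ZMod n)} {w : ℤ} :
    Coloring θ y (A ++ B) x w x' ↔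
      ∃ w₁ w₂ z, Coloring θ y A x w₁ z ∧ Coloring θ y B z w₂ x' ∧ w = w₁ + w₂ := by
  induction A generalizing x w with
  | nil =>
    constructor
    · exact fun h => ⟨0, w, x, ⟨rfl, rfl⟩, h, by simp⟩
    · rintro ⟨w₁, w₂, z, ⟨rfl, rfl⟩, h, rfl⟩
      simpa using h
  | cons L A ih =>
    constructor
    · rintro ⟨w₁, w₂, z, h₁, h₂, rfl⟩
      obtain ⟨w₃, w₄, z', h₃, h₄, rfl⟩ := ih.1 h₂
      exact ⟨w₁ + w₃, w₄, z', ⟨w₁, w₃, z, h₁, h₃, rfl⟩, h₄, by ring⟩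
    · rintro ⟨w₁, w₂, z, ⟨w₃, w₄, z', h₁, h₂, rfl⟩, h, rfl⟩
      exact ⟨w₃, w₄ + w₂, z', h₁, ih.2 ⟨w₄, w₂, z, h₂, h, rfl⟩, by ring⟩

lemma layerColoring_widen {l r : List Bool} {L : Layer} {y : Region n} {u v c : List (ZMod n)}
    {x' : List (ZMod n)} {w : ℤ} (hu : u.length = l.length) (hc : c.length = r.length)
    (hv : v.length = L.bot.length) :
    LayerColoring θ (L.widen l r) y (u ++ v ++ c) w x' ↔
      ∃ v', LayerColoring θ L (y.past u) v w v' ∧ x' = u ++ v' ++ c := by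
  constructor
  · rintro ⟨l', p, p', r', hl, hr, h, rfl, hp⟩
    simp only [Layer.widen, List.length_append] at hl hr hp
    obtain ⟨l₁, l₂, rfl, hl₁⟩ : ∃ l₁ l₂, l' = l₁ ++ l₂ ∧ l₁.length = l.length :=
      ⟨l'.take l.length, l'.drop l.length, by simp, by simp [hl]⟩
    obtain ⟨r₁, r₂, rfl, hr₂⟩ : ∃ r₁ r₂, r' = r₁ ++ r₂ ∧ r₁.length = L.right.length :=
      ⟨r'.take L.right.length, r'.drop L.right.length, by simp, by simp [hr]⟩
    simp only [List.append_assoc] at h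
    obtain ⟨rfl, h'⟩ := List.append_inj h (by omega)
    rw [← List.append_assoc p, ← List.append_assoc l₂] at h'
    rw [List.length_append] at hr
    obtain ⟨rfl, rfl⟩ := List.append_inj' h' (by omega)
    simp only [List.length_append] at hl
    exact ⟨l₂ ++ p' ++ r₁, ⟨l₂, p, p', r₁, by omega, hr₂, by simp, rfl, by simpa using hp⟩, by simp⟩
  · rintro ⟨v', ⟨l', p, p', r', hl, hr, rfl, rfl, hp⟩, rfl⟩
    exact ⟨u ++ l', p, p', r' ++ c, by simp [Layer.widen, hu, hl], by simp [Layer.widen, hc, hr],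
      by simp, by simp, by simpa [Layer.widen] using hp⟩

/-- This makes the argument local: strands outside the disc of a move keep their colours and
influence the inside only through the region `y.past u`. -/
lemma coloring_widen {l r a b : List Bool} {T : List Layer} {y : Region n}
    {u v c : List (ZMod n)} {x' : List (ZMod n)} {w : ℤ} (hT : IsTangle a T b)
    (hu : u.length = l.length) (hc : c.length = r.length) (hv : v.length = a.length) :
    Coloring θ y (T.map (Layer.widen l r)) (u ++ v ++ c) w x' ↔
      ∃ v', Coloring θ (y.past u) T v w v' ∧ x' = u ++ v' ++ c := by
  induction T generalizing a v w with
  | nil =>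
    constructor
    · rintro ⟨rfl, rfl⟩
      exact ⟨v, ⟨rfl, rfl⟩, rfl⟩
    · rintro ⟨v', ⟨rfl, rfl⟩, rfl⟩
      exact ⟨rfl, rfl⟩
  | cons L T ih =>
    obtain ⟨rfl, hT⟩ := hT
    constructor
    · rintro ⟨w₁, w₂, z, h₁, h₂, rfl⟩
      obtain ⟨v₁, h₃, rfl⟩ := (layerColoring_widen hu hc hv).1 h₁
      obtain ⟨v₂, h₄, rfl⟩ := (ih hT h₃.length_top).1 h₂
      exact ⟨v₂, ⟨w₁, w₂, v₁, h₃, h₄, rfl⟩, rfl⟩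
    · rintro ⟨v', ⟨w₁, w₂, z, h₁, h₂, rfl⟩, rfl⟩
      exact ⟨w₁, w₂, u ++ z ++ c, (layerColoring_widen hu hc hv).2 ⟨z, h₁, rfl⟩,
        (ih hT h₁.length_top).2 ⟨v', h₂, rfl⟩, rfl⟩

/-! ### Behaviour under the moves -/

/-- Every colouring of `T` corresponds to a colouring of `T'` with the same ends whose weight
differs by at most `B`. -/
def Transfers (θ : Weight n) (B : ℤ) (a : List Bool) (T T' : List Layer) : Prop :=
  ∀ (y : Region n) (x : List (ZMod n)) (w : ℤ) (x' : List (ZMod n)), x.length = a.length →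
    Coloring θ y T x w x' → ∃ w', Coloring θ y T' x w' x' ∧ |w - w'| ≤ B

/-- The condition on a weight to change by at most `B` under a move of type III and not at all
under the other moves. -/
structure Weight.Bounded (θ : Weight n) (B : ℤ) : Prop where
  diag : ∀ y a, θ y a a = 0
  coboundary : ∀ y a b c,
    |θ y a b - θ (y.across c) (2 * c - a) (2 * c - b) - θ y a c + θ (y.across b) (2 * b - a) c
      + θ y b c - θ (y.across a) b c| ≤ B

lemma layerColoring_cup {L R : List Bool} {o : Bool} {y : Region n} {x x' : List (ZMod n)} {w : ℤ} :
    LayerColoring θ ⟨L, .cup o, R⟩ y x w x' ↔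
      ∃ l r c, l.length = L.length ∧ r.length = R.length ∧ x = l ++ r ∧ x' = l ++ c :: c :: r ∧
        w = 0 := by
  constructor
  · rintro ⟨l, p, p', r, hl, hr, rfl, rfl, ⟨⟩⟩
    exact ⟨l, r, _, hl, hr, by simp, by simp; rfl, rfl⟩
  · rintro ⟨l, r, c, hl, hr, rfl, rfl, rfl⟩
    exact ⟨l, _, _, r, hl, hr, by simp, by simp, .cup o c⟩

lemma layerColoring_cap {L R : List Bool} {o : Bool} {y : Region n} {x x' : List (ZMod n)} {w : ℤ} :
    LayerColoring θ ⟨L, .cap o, R⟩ y x w x' ↔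
      ∃ l r c, l.length = L.length ∧ r.length = R.length ∧ x = l ++ c :: c :: r ∧ x' = l ++ r ∧
        w = 0 := by
  constructor
  · rintro ⟨l, p, p', r, hl, hr, rfl, rfl, ⟨⟩⟩
    exact ⟨l, r, _, hl, hr, by simp; rfl, by simp, rfl⟩
  · rintro ⟨l, r, c, hl, hr, rfl, rfl, rfl⟩
    exact ⟨l, _, _, r, hl, hr, by simp, by simp, .cap o c⟩

lemma layerColoring_cross {L R : List Bool} {b o₁ o₂ : Bool} {y : Region n}
    {x x' : List (ZMod n)} {w : ℤ} :
    LayerColoring θ ⟨L, .cross b o₁ o₂, R⟩ y x w x' ↔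
      ∃ l r c₁ c₂, l.length = L.length ∧ r.length = R.length ∧ x = l ++ c₁ :: c₂ :: r ∧
        x' = l ++ topLeft b c₁ c₂ :: topRight b c₁ c₂ :: r ∧
        w = θ.crossing b o₁ o₂ (y.past l) c₁ c₂ := by
  constructor
  · rintro ⟨l, p, p', r, hl, hr, rfl, rfl, ⟨⟩⟩
    exact ⟨l, r, _, _, hl, hr, by simp, by simp, rfl⟩
  · rintro ⟨l, r, c₁, c₂, hl, hr, rfl, rfl, rfl⟩
    exact ⟨l, _, _, r, hl, hr, by simp, by simp, .cross b o₁ o₂ c₁ c₂⟩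

lemma Transfers.of_exchange (p q : Piece) (m : List Bool) :
    Transfers θ 0 (p.bot ++ m ++ q.bot)
      [⟨[], p, m ++ q.bot⟩, ⟨p.top ++ m, q, []⟩] [⟨p.bot ++ m, q, []⟩, ⟨[], p, m ++ q.top⟩] ∧
    Transfers θ 0 (p.bot ++ m ++ q.bot)
      [⟨p.bot ++ m, q, []⟩, ⟨[], p, m ++ q.top⟩] [⟨[], p, m ++ q.bot⟩, ⟨p.top ++ m, q, []⟩] := by
  constructor
  · rintro y x w x' - ⟨w₁, _, z, ⟨l, u, u', r, hl, hr, rfl, rfl, hp⟩,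
      ⟨w₂, _, z', ⟨l', v, v', r', hl', hr', h, rfl, hq⟩, ⟨rfl, rfl⟩, rfl⟩, rfl⟩
    obtain rfl := List.eq_nil_of_length_eq_zero hl
    obtain rfl := List.eq_nil_of_length_eq_zero hr'
    simp only [List.length_append, hp.length_top.symm] at hl' hr
    obtain ⟨l₁, l₂, rfl, h₁⟩ : ∃ l₁ l₂, l' = l₁ ++ l₂ ∧ l₁.length = u'.length :=
      ⟨l'.take u'.length, l'.drop u'.length, by simp, by simp [hl']⟩
    simp only [List.nil_append, List.append_nil, List.append_assoc] at h
    obtain ⟨rfl, rfl⟩ := List.append_inj h h₁.symm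
    simp only [List.length_append] at hl'
    refine ⟨w₂ + (w₁ + 0), ⟨w₂, _, u ++ l₂ ++ v', ⟨u ++ l₂, v, v', [], ?_, rfl, by simp, by simp, ?_⟩,
      ⟨w₁, 0, u' ++ l₂ ++ v', ⟨[], u, u', l₂ ++ v', rfl, ?_, by simp, by simp, hp⟩, ⟨by simp, rfl⟩,
      rfl⟩, rfl⟩, by simp [add_comm]⟩
    · simp [hp.length_bot]; omega
    -- The region to the left of `q` is the same whether it is reached below or above `p`, so the
    -- weight of `q` does not change.
    · have := hp.past_eq
      simp only [Region.past_append, Region.past_nil] at this hq ⊢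
      rwa [← this]
    · simp [hq.length_top]; omega
  · rintro y x w x' - ⟨w₁, _, z, ⟨l, v, v', r, hl, hr, rfl, rfl, hq⟩,
      ⟨w₂, _, z', ⟨l', u, u', r', hl', hr', h, rfl, hp⟩, ⟨rfl, rfl⟩, rfl⟩, rfl⟩
    obtain rfl := List.eq_nil_of_length_eq_zero hr
    obtain rfl := List.eq_nil_of_length_eq_zero hl'
    simp only [List.length_append, hp.length_bot.symm] at hl hr'
    obtain ⟨l₁, l₂, rfl, h₁⟩ : ∃ l₁ l₂, l = l₁ ++ l₂ ∧ l₁.length = u.length :=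
      ⟨l.take u.length, l.drop u.length, by simp, by simp [hl]⟩
    simp only [List.nil_append, List.append_nil, List.append_assoc] at h
    obtain ⟨rfl, rfl⟩ := List.append_inj h h₁
    simp only [List.length_append] at hl
    refine ⟨w₂ + (w₁ + 0), ⟨w₂, _, u' ++ l₂ ++ v, ⟨[], l₁, u', l₂ ++ v, rfl, ?_, by simp, by simp, hp⟩,
      ⟨w₁, 0, u' ++ l₂ ++ v', ⟨u' ++ l₂, v, v', [], ?_, rfl, by simp, by simp, ?_⟩, ⟨by simp, rfl⟩,
      rfl⟩, rfl⟩, by simp [add_comm]⟩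
    · simp [hq.length_bot]; omega
    · simp [hp.length_top]; omega
    · have := hp.past_eq
      simp only [Region.past_append, Region.past_nil] at this hq ⊢
      rwa [this]

/-! ### Contributions of crossings under the local moves -/

lemma Weight.crossing_diag (hθ : ∀ y a, θ y a a = 0) (b o₁ o₂ : Bool) (y : Region n) (c : ZMod n) :
    θ.crossing b o₁ o₂ y c c = 0 := by
  have h : 2 * c - c = c := by ring
  cases b <;> cases o₁ <;> cases o₂ <;> simp [Weight.crossing, topLeft, topRight, hθ, h]

/-- The two crossings of a bigon have opposite signs, while their source regions, adjacent
under-arcs and over-arcs carry the same colours. -/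
lemma Weight.crossing_cancel (b o₁ o₂ : Bool) (y : Region n) (c₁ c₂ : ZMod n) :
    θ.crossing (!b) o₂ o₁ y (topLeft b c₁ c₂) (topRight b c₁ c₂) = -θ.crossing b o₁ o₂ y c₁ c₂ := by
  cases b <;> cases o₁ <;> cases o₂ <;>
    simp [Weight.crossing, topLeft, topRight, source, Region.across] <;> ring_nf

/-- Both sides describe one crossing, turned counterclockwise by a quarter turn. Sign, source region
and over-strand do not depend on the height function. This is what sliding an extremum through a
crossing needs. -/
lemma Weight.crossing_rotate (b o₁ o₂ : Bool) (y : Region n) (c₁ c₂ : ZMod n) :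
    θ.crossing (!b) (!o₂) o₁ y (topLeft b c₁ c₂) c₁ =
      θ.crossing b o₁ o₂ (y.across (topLeft b c₁ c₂)) c₁ c₂ := by
  cases b <;> cases o₁ <;> cases o₂ <;>
    simp [Weight.crossing, topLeft, topRight, source, Region.across] <;> ring_nf

@[simp] lemma topLeft_not_topLeft (b : Bool) (c₁ c₂ : ZMod n) :
    topLeft (!b) (topLeft b c₁ c₂) c₁ = topRight b c₁ c₂ := by
  cases b <;> simp [topLeft, topRight]

@[simp] lemma topRight_not_topLeft (b : Bool) (c₁ c₂ : ZMod n) :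
    topRight (!b) (topLeft b c₁ c₂) c₁ = c₂ := by
  cases b <;> simp [topLeft, topRight]

@[simp] lemma topLeft_topRight_not (b : Bool) (c₁ c₂ : ZMod n) :
    topLeft b c₂ (topRight (!b) c₁ c₂) = c₁ := by
  cases b <;> simp [topLeft, topRight]

@[simp] lemma topLeft_not_top (b : Bool) (c₁ c₂ : ZMod n) :
    topLeft (!b) (topLeft b c₁ c₂) (topRight b c₁ c₂) = c₁ := by
  cases b <;> simp [topLeft, topRight]

@[simp] lemma topRight_not_top (b : Bool) (c₁ c₂ : ZMod n) :
    topRight (!b) (topLeft b c₁ c₂) (topRight b c₁ c₂) = c₂ := by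
  cases b <;> simp [topLeft, topRight]

lemma topLeft_eq_iff (b : Bool) (c₁ c₂ : ZMod n) : topLeft b c₁ c₂ = c₁ ↔ c₂ = c₁ := by
  cases b
  · simp [topLeft]
  · simp only [topLeft, if_true]
    exact ⟨fun h => by linear_combination -h, fun h => by rw [h]; ring⟩

lemma topRight_eq_iff (b : Bool) (c₁ c₂ : ZMod n) : topRight b c₁ c₂ = c₂ ↔ c₁ = c₂ := by
  cases b
  · simp only [topRight, Bool.false_eq_true, if_false]
    exact ⟨fun h => by linear_combination -h, fun h => by rw [h]; ring⟩
  · simp [topRight]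

/-- For the acyclic over-under patterns this is the self-distributivity of `2 * c - a`: reflections
are automorphisms of the colours. -/
lemma triangle_colors (b₁₂ b₁₃ b₂₃ : Bool) (h : b₁₂ = b₂₃ → b₁₃ = b₁₂) (x₁ x₂ x₃ : ZMod n) :
    topLeft b₂₃ (topLeft b₁₂ x₁ x₂) (topLeft b₁₃ (topRight b₁₂ x₁ x₂) x₃) =
      topLeft b₁₃ x₁ (topLeft b₂₃ x₂ x₃) ∧
    topRight b₂₃ (topLeft b₁₂ x₁ x₂) (topLeft b₁₃ (topRight b₁₂ x₁ x₂) x₃) =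
      topLeft b₁₂ (topRight b₁₃ x₁ (topLeft b₂₃ x₂ x₃)) (topRight b₂₃ x₂ x₃) ∧
    topRight b₁₃ (topRight b₁₂ x₁ x₂) x₃ =
      topRight b₁₂ (topRight b₁₃ x₁ (topLeft b₂₃ x₂ x₃)) (topRight b₂₃ x₂ x₃) := by
  cases b₁₂ <;> cases b₁₃ <;> cases b₂₃ <;> simp [topLeft, topRight] at h ⊢ <;> ring

/-- The bound for the coboundary of a weight at a triple point, with the colours as seen from the
region `y` on the left of three strands of colours `a` (bottom), `b` (middle), `c` (top) whose
orientations are given by `oa`, `ob`, `oc`. -/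
lemma Weight.Bounded.coboundary_oriented {B : ℤ} (hθ : θ.Bounded B) (oa ob oc : Bool)
    (y : Region n) (a b c : ZMod n) :
    let b' := if oc then b else 2 * c - b
    let a₁ := if oc then a else 2 * c - a
    let a' := if ob then a₁ else 2 * b' - a₁
    let y₁ := if oc then y else y.across c
    let y₂ := if ob then y₁ else y₁.across b'
    let y' := if oa then y₂ else y₂.across a'
    |θ y' a' b' - θ (y'.across c) (2 * c - a') (2 * c - b') - θ y' a' c
      + θ (y'.across b') (2 * b' - a') c + θ y' b' c - θ (y'.across a') b' c| ≤ B :=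
  hθ.coboundary _ _ _ _

set_option maxHeartbeats 4000000 in
lemma Weight.Bounded.triangle {B : ℤ} (hθ : θ.Bounded B) (b₁₂ b₁₃ b₂₃ o₁ o₂ o₃ : Bool)
    (h : b₁₂ = b₂₃ → b₁₃ = b₁₂) (y : Region n) (x₁ x₂ x₃ : ZMod n) :
    |(θ.crossing b₁₂ o₁ o₂ y x₁ x₂ +
        θ.crossing b₁₃ o₁ o₃ (y.across (topLeft b₁₂ x₁ x₂)) (topRight b₁₂ x₁ x₂) x₃ +
        θ.crossing b₂₃ o₂ o₃ y (topLeft b₁₂ x₁ x₂) (topLeft b₁₃ (topRight b₁₂ x₁ x₂) x₃)) -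
      (θ.crossing b₂₃ o₂ o₃ (y.across x₁) x₂ x₃ +
        θ.crossing b₁₃ o₁ o₃ y x₁ (topLeft b₂₃ x₂ x₃) +
        θ.crossing b₁₂ o₁ o₂ (y.across (topLeft b₁₃ x₁ (topLeft b₂₃ x₂ x₃)))
          (topRight b₁₃ x₁ (topLeft b₂₃ x₂ x₃)) (topRight b₂₃ x₂ x₃))| ≤ B := by
  have of_perm (oa ob oc : Bool) (a b c : ZMod n) := hθ.coboundary_oriented oa ob oc y a b c
  cases b₁₂ <;> cases b₁₃ <;> cases b₂₃ <;> simp at h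
  -- The six acyclic orders remain. In each, the strands are listed as bottom, middle, top, with the
  -- colours of their arcs that border `y` in the first picture.
  on_goal 1 => specialize of_perm o₁ o₂ o₃ x₁ x₂ x₃
  on_goal 2 => specialize of_perm o₁ o₃ o₂ x₁ (2 * x₂ - x₃) x₂
  on_goal 3 => specialize of_perm o₃ o₁ o₂ (2 * x₁ - (2 * x₂ - x₃)) x₁ x₂
  on_goal 4 => specialize of_perm o₂ o₁ o₃ (2 * x₁ - x₂) x₁ x₃
  on_goal 5 => specialize of_perm o₂ o₃ o₁ (2 * x₁ - x₂) (2 * x₁ - x₃) x₁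
  on_goal 6 => specialize of_perm o₃ o₂ o₁ (2 * x₁ - (2 * x₂ - x₃)) (2 * x₁ - x₂) x₁
  all_goals
    cases o₁ <;> cases o₂ <;> cases o₃ <;>
    · simp [Weight.crossing, topLeft, topRight, source, Region.across] at of_perm ⊢
      ring_nf at of_perm ⊢
      -- The change of weight equals the coboundary only up to a sign depending on the case;
      -- splitting into two inequalities covers both signs.
      rw [abs_le] at of_perm ⊢
      constructor <;> linarith

lemma Coloring.cons_iff {y : Region n} {L : Layer} {T : List Layer} {x x' : List (ZMod n)} {w : ℤ} :
    Coloring θ y (L :: T) x w x' ↔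
      ∃ w₁ w₂ z, LayerColoring θ L y x w₁ z ∧ Coloring θ y T z w₂ x' ∧ w = w₁ + w₂ := Iff.rfl

lemma Coloring.nil_iff {y : Region n} {x x' : List (ZMod n)} {w : ℤ} :
    Coloring θ y [] x w x' ↔ x = x' ∧ w = 0 := Iff.rfl

lemma Transfers.of_triangle {B : ℤ} (hθ : θ.Bounded B) (b₁₂ b₁₃ b₂₃ o₁ o₂ o₃ : Bool)
    (h : b₁₂ = b₂₃ → b₁₃ = b₁₂) :
    let T : List Layer := [⟨[], .cross b₁₂ o₁ o₂, [o₃]⟩, ⟨[o₂], .cross b₁₃ o₁ o₃, []⟩,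
      ⟨[], .cross b₂₃ o₂ o₃, [o₁]⟩]
    let T' : List Layer := [⟨[o₁], .cross b₂₃ o₂ o₃, []⟩, ⟨[], .cross b₁₃ o₁ o₃, [o₂]⟩,
      ⟨[o₃], .cross b₁₂ o₁ o₂, []⟩]
    Transfers θ B [o₁, o₂, o₃] T T' ∧ Transfers θ B [o₁, o₂, o₃] T' T := by
  intro T T'
  constructor <;> intro y x w x' hx hc <;> obtain ⟨x₁, x₂, x₃, rfl⟩ := List.length_eq_three.1 hx <;>
    have hc' := triangle_colors b₁₂ b₁₃ b₂₃ h x₁ x₂ x₃ <;>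
    have hw := hθ.triangle b₁₂ b₁₃ b₂₃ o₁ o₂ o₃ h y x₁ x₂ x₃ <;>
    simp [T, T', Coloring.cons_iff, Coloring.nil_iff, layerColoring_cross,
      List.length_eq_one_iff] at hc ⊢ <;>
    obtain ⟨rfl, rfl⟩ := hc <;>
    simp only [add_assoc] at hw
  · exact ⟨by simp [hc'], hw⟩
  · exact ⟨by simp [hc'], by rwa [abs_sub_comm]⟩

lemma Transfers.of_bigon (b o₁ o₂ : Bool) :
    let T : List Layer := [⟨[], .cross b o₁ o₂, []⟩, ⟨[], .cross (!b) o₂ o₁, []⟩]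
    Transfers θ 0 [o₁, o₂] T [] ∧ Transfers θ 0 [o₁, o₂] [] T := by
  intro T
  constructor <;> intro y x w x' hx hc <;> obtain ⟨x₁, x₂, rfl⟩ := List.length_eq_two.1 hx <;>
    simp [T, Coloring.cons_iff, Coloring.nil_iff, layerColoring_cross,
      Weight.crossing_cancel] at hc ⊢ <;>
    simp [hc]

/-- The closing loop forces the two colours at the crossing to agree, and there `θ` vanishes. -/
lemma Transfers.of_kinkRight (hθ : ∀ y a, θ y a a = 0) (b o : Bool) :
    let T : List Layer := [⟨[o], .cup o, []⟩, ⟨[], .cross b o o, [!o]⟩, ⟨[o], .cap o, []⟩]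
    Transfers θ 0 [o] T [] ∧ Transfers θ 0 [o] [] T := by
  intro T
  constructor <;> intro y x w x' hx hc <;> obtain ⟨x₁, rfl⟩ := List.length_eq_one_iff.1 hx <;>
    simp [T, Coloring.cons_iff, Coloring.nil_iff, layerColoring_cross, layerColoring_cup,
      layerColoring_cap, List.length_eq_one_iff, @eq_comm _ _ (topRight b _ _), topRight_eq_iff,
      Weight.crossing_diag hθ, (topLeft_eq_iff _ _ _).2] at hc ⊢ <;>
    simp [hc]

lemma Transfers.of_kinkLeft (hθ : ∀ y a, θ y a a = 0) (b o : Bool) :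
    let T : List Layer := [⟨[], .cup (!o), [o]⟩, ⟨[!o], .cross b o o, []⟩, ⟨[], .cap (!o), [o]⟩]
    Transfers θ 0 [o] T [] ∧ Transfers θ 0 [o] [] T := by
  intro T
  constructor <;> intro y x w x' hx hc <;> obtain ⟨x₁, rfl⟩ := List.length_eq_one_iff.1 hx <;>
    simp [T, Coloring.cons_iff, Coloring.nil_iff, layerColoring_cross, layerColoring_cup,
      layerColoring_cap, List.length_eq_one_iff, @eq_comm _ _ (topLeft b _ _), topLeft_eq_iff,
      Weight.crossing_diag hθ, (topRight_eq_iff _ _ _).2] at hc ⊢ <;>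
    simp [hc]

lemma Transfers.of_zigzagLeft (o : Bool) :
    let T : List Layer := [⟨[o], .cup (!o), []⟩, ⟨[], .cap o, [o]⟩]
    Transfers θ 0 [o] T [] ∧ Transfers θ 0 [o] [] T := by
  intro T
  constructor <;> intro y x w x' hx hc <;> obtain ⟨x₁, rfl⟩ := List.length_eq_one_iff.1 hx <;>
    simp [T, Coloring.cons_iff, Coloring.nil_iff, layerColoring_cup,
      layerColoring_cap, List.length_eq_one_iff] at hc ⊢ <;>
    simp [hc]

lemma Transfers.of_zigzagRight (o : Bool) :
    let T : List Layer := [⟨[], .cup o, [o]⟩, ⟨[o], .cap (!o), []⟩]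
    Transfers θ 0 [o] T [] ∧ Transfers θ 0 [o] [] T := by
  intro T
  constructor <;> intro y x w x' hx hc <;> obtain ⟨x₁, rfl⟩ := List.length_eq_one_iff.1 hx <;>
    simp [T, Coloring.cons_iff, Coloring.nil_iff, layerColoring_cup,
      layerColoring_cap, List.length_eq_one_iff] at hc ⊢ <;>
    simp [hc]

lemma topRight_topRight_not (b : Bool) (c₁ c₂ : ZMod n) :
    topRight b c₂ (topRight (!b) c₁ c₂) = topLeft (!b) c₁ c₂ := by
  cases b <;> simp [topLeft, topRight]

lemma Weight.crossing_rotate' (b o₁ o₂ : Bool) (y : Region n) (c₁ c₂ : ZMod n) :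
    θ.crossing b o₂ (!o₁) (y.across c₁) c₂ (topRight (!b) c₁ c₂) =
      θ.crossing (!b) o₁ o₂ y c₁ c₂ := by
  simpa using (θ.crossing_rotate b o₂ (!o₁) y c₂ (topRight (!b) c₁ c₂)).symm

lemma Transfers.of_slideCap (b u s : Bool) :
    let T : List Layer := [⟨[u], .cross b s (!u), []⟩, ⟨[], .cap u, [s]⟩]
    let T' : List Layer := [⟨[], .cross (!b) u s, [!u]⟩, ⟨[s], .cap u, []⟩]
    Transfers θ 0 [u, s, !u] T T' ∧ Transfers θ 0 [u, s, !u] T' T := by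
  intro T T'
  constructor <;> intro y x w x' hx hc <;> obtain ⟨x₁, x₂, x₃, rfl⟩ := List.length_eq_three.1 hx <;>
    simp [T, T', Coloring.cons_iff, Coloring.nil_iff, layerColoring_cross,
      layerColoring_cap, List.length_eq_one_iff] at hc ⊢ <;>
    obtain ⟨⟨rfl, rfl⟩, rfl⟩ := hc
  · have := θ.crossing_rotate b s (!u) y x₂ x₃
    rw [Bool.not_not] at this
    simp [this]
  · simp [Weight.crossing_rotate', topRight_topRight_not]

lemma Transfers.of_slideCup (b u s : Bool) :
    let T : List Layer := [⟨[s], .cup u, []⟩, ⟨[], .cross b s u, [!u]⟩]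
    let T' : List Layer := [⟨[], .cup u, [s]⟩, ⟨[u], .cross (!b) (!u) s, []⟩]
    Transfers θ 0 [s] T T' ∧ Transfers θ 0 [s] T' T := by
  intro T T'
  constructor <;> intro y x w x' hx hc <;> obtain ⟨x₁, rfl⟩ := List.length_eq_one_iff.1 hx <;>
    simp [T, T', Coloring.cons_iff, Coloring.nil_iff, layerColoring_cross,
      layerColoring_cup, List.length_eq_one_iff] at hc ⊢ <;>
    obtain ⟨c, rfl, rfl⟩ := hc
  · have := θ.crossing_rotate b s u (y.across (topLeft b x₁ c)) x₁ c
    rw [Region.across_across] at this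
    -- The minimum now lies on the other side of the strand coloured `x₁`, so it takes the colour
    -- that its left leg had beyond the crossing.
    exact ⟨topLeft b x₁ c, by simp [this]⟩
  · have := θ.crossing_rotate' b (!u) s (y.across c) c x₁
    rw [Region.across_across, Bool.not_not] at this
    exact ⟨topRight (!b) c x₁, by simp [this, topRight_topRight_not]⟩

/-- The amount by which the weight may change under a move. -/
def MoveKind.cost (B : ℤ) (k : MoveKind) : ℤ := if k = .typeIII then B else 0

/-- The clause `T ≠ []` guarantees that at least one side of the picture displays the strands
entering it; the other side may be empty. -/
lemma Local.transfers {B : ℤ} (hθ : θ.Bounded B) {k : MoveKind} {T T' : List Layer}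
    (h : Local k T T') :
    ∃ a b, IsTangle a T b ∧ IsTangle a T' b ∧ T ≠ [] ∧
      Transfers θ (k.cost B) a T T' ∧ Transfers θ (k.cost B) a T' T := by
  cases h with
  | exchange p q m =>
    exact ⟨_, p.top ++ m ++ q.top, by simp [IsTangle, Layer.bot, Layer.top],
      by simp [IsTangle, Layer.bot, Layer.top], by simp, Transfers.of_exchange p q m⟩
  | zigzagLeft o =>
    exact ⟨_, [o], by simp [IsTangle, Layer.bot, Layer.top, Piece.bot, Piece.top], rfl, by simp,
      Transfers.of_zigzagLeft o⟩
  | zigzagRight o =>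
    exact ⟨_, [o], by simp [IsTangle, Layer.bot, Layer.top, Piece.bot, Piece.top], rfl, by simp,
      Transfers.of_zigzagRight o⟩
  | slideCap b u s =>
    exact ⟨_, [s], by simp [IsTangle, Layer.bot, Layer.top, Piece.bot, Piece.top],
      by simp [IsTangle, Layer.bot, Layer.top, Piece.bot, Piece.top], by simp,
      Transfers.of_slideCap b u s⟩
  | slideCup b u s =>
    exact ⟨_, [u, s, !u], by simp [IsTangle, Layer.bot, Layer.top, Piece.bot, Piece.top],
      by simp [IsTangle, Layer.bot, Layer.top, Piece.bot, Piece.top], by simp,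
      Transfers.of_slideCup b u s⟩
  | kinkRight b o =>
    exact ⟨_, [o], by simp [IsTangle, Layer.bot, Layer.top, Piece.bot, Piece.top], rfl, by simp,
      Transfers.of_kinkRight hθ.diag b o⟩
  | kinkLeft b o =>
    exact ⟨_, [o], by simp [IsTangle, Layer.bot, Layer.top, Piece.bot, Piece.top], rfl, by simp,
      Transfers.of_kinkLeft hθ.diag b o⟩
  | bigon b o₁ o₂ =>
    exact ⟨_, [o₁, o₂], by simp [IsTangle, Layer.bot, Layer.top, Piece.bot, Piece.top], rfl,
      by simp, Transfers.of_bigon b o₁ o₂⟩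
  | triangle b₁₂ b₁₃ b₂₃ o₁ o₂ o₃ h =>
    exact ⟨_, [o₃, o₂, o₁], by simp [IsTangle, Layer.bot, Layer.top, Piece.bot, Piece.top],
      by simp [IsTangle, Layer.bot, Layer.top, Piece.bot, Piece.top], by simp,
      Transfers.of_triangle hθ b₁₂ b₁₃ b₂₃ o₁ o₂ o₃ h⟩

/-! ### From local pictures to whole diagrams -/

lemma isTangle_append {a b : List Bool} {A B : List Layer} :
    IsTangle a (A ++ B) b ↔ ∃ s, IsTangle a A s ∧ IsTangle s B b := by
  induction A generalizing a with
  | nil => simp [IsTangle]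
  | cons L A ih => simp [IsTangle, ih, and_assoc]

lemma IsTangle.top_unique {a s s' : List Bool} {A : List Layer} (h : IsTangle a A s)
    (h' : IsTangle a A s') : s = s' := by
  induction A generalizing a with
  | nil => exact (Eq.symm h).trans h'
  | cons L A ih => exact ih h.2 h'.2

lemma IsTangle.bot_of_widen {a b l r s t : List Bool} {T : List Layer} (h : IsTangle a T b)
    (hT : T ≠ []) (h' : IsTangle s (T.map (Layer.widen l r)) t) : s = l ++ a ++ r := by
  obtain - | ⟨L, T⟩ := T
  · exact absurd rfl hT
  · rw [h'.1, h.1]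
    simp [Layer.widen, Layer.bot]

/-- The colourings of a diagram with the unbounded region coloured `y`. -/
def Diagram.HasWeight (θ : Weight n) (y : Region n) (D : Diagram) (w : ℤ) : Prop :=
  Coloring θ y D.layers [] w []

lemma Move.hasWeight {B : ℤ} (hθ : θ.Bounded B) {k : MoveKind} {D D' : Diagram}
    (h : Move k D D') {y : Region n} {w : ℤ} (hw : D.HasWeight θ y w) :
    ∃ w', D'.HasWeight θ y w' ∧ |w - w'| ≤ k.cost B := by
  obtain ⟨A, C, l, r, T, T', hT, hD, hD'⟩ := h
  obtain ⟨a, b, b', hta, hta', hne, htr⟩ : ∃ a b b', IsTangle a T b ∧ IsTangle a T' b' ∧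
      (T ≠ [] ∨ T' ≠ []) ∧ Transfers θ (k.cost B) a T T' := by
    obtain hT | hT := hT
    · obtain ⟨a, b, h₁, h₂, h₃, h₄, -⟩ := hT.transfers hθ
      exact ⟨a, b, b, h₁, h₂, .inl h₃, h₄⟩
    · obtain ⟨a, b, h₁, h₂, h₃, -, h₄⟩ := hT.transfers hθ
      exact ⟨a, b, b, h₂, h₁, .inr h₃, h₄⟩
  have hc := D.closed
  have hc' := D'.closed
  rw [hD, List.append_assoc, isTangle_append] at hc
  rw [hD', List.append_assoc, isTangle_append] at hc'
  obtain ⟨s, hs, hc⟩ := hc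
  obtain ⟨s', hs', hc'⟩ := hc'
  obtain rfl := hs.top_unique hs'
  obtain ⟨t, ht, -⟩ := isTangle_append.1 hc
  obtain ⟨t', ht', -⟩ := isTangle_append.1 hc'
  -- Both diagrams share the layers below the move, hence the strands `s`; these are read off from
  -- whichever side of the move is nonempty.
  obtain rfl : s = l ++ a ++ r := by
    obtain hne | hne := hne
    · exact hta.bot_of_widen hne ht
    · exact hta'.bot_of_widen hne ht'
  rw [Diagram.HasWeight, hD, List.append_assoc] at hw
  obtain ⟨w₁, _, x, h₁, h₂, rfl⟩ := coloring_append.1 hw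
  obtain ⟨w₂, w₃, x', h₄, h₃, rfl⟩ := coloring_append.1 h₂
  have hx := h₁.length_top hs rfl
  obtain ⟨u, v, c, rfl, hu, hv, hc⟩ : ∃ u v c, x = u ++ v ++ c ∧ u.length = l.length ∧
      v.length = a.length ∧ c.length = r.length := by
    simp only [List.length_append] at hx
    exact ⟨x.take l.length, (x.drop l.length).take a.length, (x.drop l.length).drop a.length,
      by simp, by simp; omega, by simp; omega, by simp; omega⟩
  obtain ⟨v', h₅, rfl⟩ := (coloring_widen hta hu hc hv).1 h₄
  obtain ⟨w', h₆, hww⟩ := htr _ _ _ _ hv h₅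
  refine ⟨w₁ + (w' + w₃), ?_, by ring_nf at hww ⊢; exact hww⟩
  rw [Diagram.HasWeight, hD', List.append_assoc]
  exact coloring_append.2 ⟨w₁, _, _, h₁, coloring_append.2
    ⟨w', w₃, _, (coloring_widen hta' hu hc hv).2 ⟨v', h₆, rfl⟩, h₃, rfl⟩, rfl⟩

lemma Connects.hasWeight {B : ℤ} (hθ : θ.Bounded B) {m : ℕ} {D D' : Diagram}
    (h : Connects m D D') {y : Region n} {w : ℤ} (hw : D.HasWeight θ y w) :
    ∃ w', D'.HasWeight θ y w' ∧ |w - w'| ≤ m * B := by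
  induction h with
  | refl D => exact ⟨w, hw, by simp⟩
  | @step m D D' D'' k _ hk ih =>
    obtain ⟨w₁, h₁, hw₁⟩ := ih hw
    obtain ⟨w₂, h₂, hw₂⟩ := hk.hasWeight hθ h₁
    refine ⟨w₂, h₂, (abs_sub_le w w₁ w₂).trans ((add_le_add hw₁ hw₂).trans (le_of_eq ?_))⟩
    unfold MoveKind.cost
    split_ifs <;> push_cast <;> ring

/-- If some colouring of `D` has a weight that exceeds the weights of all colourings of `D'` by at
least `m` times the bound, then `m` moves of type III are necessary. -/
theorem le_omega3 {B : ℤ} (hθ : θ.Bounded B) (hB : 0 < B) {D D' : Diagram} {y : Region n} {w : ℤ}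
    {m : ℕ} (hw : D.HasWeight θ y w) (hD' : ∀ w', D'.HasWeight θ y w' → w' + m * B ≤ w) :
    (m : ℕ∞) ≤ Omega3 D D' := by
  refine le_iInf₂ fun k hk => ?_
  obtain ⟨w', hw', h⟩ := hk.hasWeight hθ hw
  have h₁ := hD' w' hw'
  have h₂ := (le_abs_self _).trans h
  have : (m : ℤ) * B ≤ k * B := by linarith
  exact_mod_cast le_of_mul_le_mul_right this hB

/-! ### Enumeration of colourings -/

/-- All colourings of an elementary piece whose bottom colours form an initial segment of `z`:
the weight, the colours at the top, and the rest of `z`. -/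
def pieceColorings (θ : Weight n) (y : Region n) :
    Piece → List (ZMod n) → List (ℤ × List (ZMod n) × List (ZMod n))
  | .cup _, r => (List.range n).map fun c : ℕ => (0, [(c : ZMod n), (c : ZMod n)], r)
  | .cap _, c :: d :: r => if c = d then [(0, [], r)] else []
  | .cross b o₁ o₂, c₁ :: c₂ :: r =>
    [(θ.crossing b o₁ o₂ y c₁ c₂, [topLeft b c₁ c₂, topRight b c₁ c₂], r)]
  | _, _ => []

/-- All colourings of a layer with bottom colours `x`. -/
def layerColorings (θ : Weight n) (y : Region n) (L : Layer) (x : List (ZMod n)) :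
    List (ℤ × List (ZMod n)) :=
  let l := x.take L.left.length
  if l.length = L.left.length then
    ((pieceColorings θ (y.past l) L.piece (x.drop L.left.length)).filter
      fun t => t.2.2.length = L.right.length).map fun t => (t.1, l ++ t.2.1 ++ t.2.2)
  else []

/-- All colourings of a tangle diagram with bottom colours `x`. -/
def colorings (θ : Weight n) (y : Region n) :
    List Layer → List (ZMod n) → List (ℤ × List (ZMod n))
  | [], x => [(0, x)]
  | L :: T, x => (layerColorings θ y L x).flatMap fun t =>
    (colorings θ y T t.2).map fun t' => (t.1 + t'.1, t'.2)

lemma mem_pieceColorings [NeZero n] {y : Region n} {p : Piece} {z p' r : List (ZMod n)} {w : ℤ} :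
    (w, p', r) ∈ pieceColorings θ y p z ↔ ∃ u, z = u ++ r ∧ PieceColoring θ y p u w p' := by
  constructor
  · intro h
    unfold pieceColorings at h
    split at h
    · obtain ⟨c, -, hc⟩ := List.mem_map.1 h
      cases hc
      exact ⟨[], rfl, .cup _ _⟩
    · split_ifs at h with hcd
      · subst hcd
        cases List.mem_singleton.1 h
        exact ⟨_, rfl, .cap _ _⟩
      · cases h
    · cases List.mem_singleton.1 h
      exact ⟨_, rfl, .cross _ _ _ _ _⟩
    · cases h
  · rintro ⟨u, rfl, h⟩
    cases h with
    | cup o c =>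
      exact List.mem_map.2 ⟨c.val, List.mem_range.2 c.val_lt, by simp⟩
    | cap o c => simp [pieceColorings]
    | cross => simp [pieceColorings]

lemma mem_layerColorings [NeZero n] {y : Region n} {L : Layer} {x x' : List (ZMod n)} {w : ℤ} :
    (w, x') ∈ layerColorings θ y L x ↔ LayerColoring θ L y x w x' := by
  constructor
  · intro h
    simp only [layerColorings] at h
    split_ifs at h with hl
    · obtain ⟨⟨w', p', r⟩, ht, he⟩ := List.mem_map.1 h
      obtain ⟨ht, hr⟩ := List.mem_filter.1 ht
      obtain ⟨u, hu, hp⟩ := mem_pieceColorings.1 ht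
      cases he
      exact ⟨_, u, p', r, hl, by simpa using hr,
        by rw [List.append_assoc, ← hu, List.take_append_drop], rfl, hp⟩
    · cases h
  · rintro ⟨l, p, p', r, hl, hr, rfl, rfl, hp⟩
    simp only [layerColorings, ← hl, ← hr, List.append_assoc, List.take_left', List.drop_left',
      if_true]
    exact List.mem_map.2 ⟨(w, p', r), List.mem_filter.2
      ⟨mem_pieceColorings.2 ⟨p, rfl, hp⟩, by simp⟩, rfl⟩

lemma mem_colorings [NeZero n] {y : Region n} {T : List Layer} {x x' : List (ZMod n)} {w : ℤ} :
    (w, x') ∈ colorings θ y T x ↔ Coloring θ y T x w x' := by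
  induction T generalizing x w with
  | nil => simp [colorings, Coloring.nil_iff, and_comm, eq_comm]
  | cons L T ih =>
    simp only [colorings, List.mem_flatMap, List.mem_map, Prod.exists, Prod.mk.injEq,
      Coloring.cons_iff]
    constructor
    · rintro ⟨w₁, z, h₁, w₂, _, h₂, rfl, rfl⟩
      exact ⟨w₁, w₂, z, mem_layerColorings.1 h₁, ih.1 h₂, rfl⟩
    · rintro ⟨w₁, w₂, z, h₁, h₂, rfl⟩
      exact ⟨w₁, z, mem_layerColorings.2 h₁, w₂, x', ih.2 h₂, rfl, rfl⟩

/-- The criterion `le_omega3` in a form that can be decided by enumeration. -/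
lemma le_omega3_of_colorings [NeZero n] {B : ℤ} (hθ : θ.Bounded B) (hB : 0 < B) {D D' : Diagram}
    {y : Region n} {m : ℕ} (h : ∃ t ∈ colorings θ y D.layers [], t.2 = [] ∧
      ∀ t' ∈ colorings θ y D'.layers [], t'.1 + m * B ≤ t.1) :
    (m : ℕ∞) ≤ Omega3 D D' := by
  obtain ⟨⟨w, _⟩, hw, rfl, h⟩ := h
  exact le_omega3 hθ hB (mem_colorings.1 hw) fun w' hw' => h (w', []) (mem_colorings.2 hw')

/-! ### Three weights and the lower bounds -/

/-- The weight with finitely many nonzero values given by a table. -/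
def Weight.ofTable (t : List ((Region n × ZMod n × ZMod n) × ℤ)) : Weight n :=
  fun y a b => (t.lookup (y, a, b)).getD 0

/-- A weight for colourings modulo 3. -/
def weightThree : Weight 3 := .ofTable
  [(((0, false), 1, 2), 1), (((2, true), 1, 0), 1), (((2, true), 2, 0), 1), (((2, true), 2, 1), 1)]

/-- A weight for colourings modulo 4. -/
def weightFour : Weight 4 := .ofTable
  [(((0, false), 0, 3), 2), (((2, false), 0, 1), 2), (((2, false), 1, 2), -1),
    (((2, false), 3, 0), -1), (((2, true), 0, 1), 1), (((2, true), 0, 3), 3),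
    (((2, true), 1, 0), 1), (((2, true), 2, 1), 1), (((2, true), 2, 3), 1), (((2, true), 3, 2), 1)]

/-- A weight for colourings modulo 5. -/
def weightFive : Weight 5 := .ofTable
  [(((0, false), 0, 3), -1), (((0, false), 1, 0), 1), (((0, false), 1, 2), 1),
    (((0, false), 4, 0), 1), (((1, true), 0, 3), -1), (((1, true), 3, 0), -1),
    (((4, false), 3, 2), 1)]

/-- A finite check: there are `2 * n` region colours and `n ^ 3` triples of strand colours. -/
lemma weightThree_bounded : weightThree.Bounded 1 where
  diag := by decide +kernel
  coboundary := by decide +kernel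

/-- Only the ratio of weight to bound matters. The bound 2 amounts to bound 1 for a half-integral
weight with denominators cleared. -/
lemma weightFour_bounded : weightFour.Bounded 2 where
  diag := by decide +kernel
  coboundary := by decide +kernel

lemma weightFive_bounded : weightFive.Bounded 1 where
  diag := by decide +kernel
  coboundary := by decide +kernel

lemma two_le_omega3_D₁_D₂ : 2 ≤ Omega3 D₁ D₂ :=
  le_omega3_of_colorings weightThree_bounded one_pos (y := (0, false)) (m := 2) (by decide +kernel)

lemma three_le_omega3_D₃_D₄ : 3 ≤ Omega3 D₃ D₄ :=
  le_omega3_of_colorings weightFive_bounded one_pos (y := (0, false)) (m := 3) (by decide +kernel)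

lemma three_le_omega3_D₅_D₆ : 3 ≤ Omega3 D₅ D₆ :=
  le_omega3_of_colorings weightFour_bounded two_pos (y := (0, false)) (m := 3) (by decide +kernel)

/-! ### Explicit sequences of moves -/

/-- A local picture of a move, read in one of the two directions. -/
structure LocalMove where
  kind : MoveKind
  before : List Layer
  after : List Layer
  isLocal : Local kind before after ∨ Local kind after before

/-- A local picture read from the left side to the right side. -/
def LocalMove.forward {k : MoveKind} {T T' : List Layer} (h : Local k T T') : LocalMove :=
  ⟨k, T, T', .inl h⟩

/-- A local picture read from the right side to the left side. -/
def LocalMove.backward {k : MoveKind} {T T' : List Layer} (h : Local k T T') : LocalMove :=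
  ⟨k, T', T, .inr h⟩

deriving instance DecidableEq for Piece
deriving instance DecidableEq for Layer

instance decidableIsTangle : ∀ (a : List Bool) (T : List Layer) (b : List Bool),
    Decidable (IsTangle a T b)
  | a, [], b => inferInstanceAs (Decidable (a = b))
  | a, L :: T, b =>
    have := decidableIsTangle L.top T b
    inferInstanceAs (Decidable (a = L.bot ∧ IsTangle L.top T b))

/-- The strands between the layers numbered `i - 1` and `i` of a diagram. -/
def strandsAt (D : List Layer) (i : ℕ) : List Bool :=
  -- The default is correct at the very bottom, where a closed diagram has no strands.
  ((D.take i).getLast?.map Layer.top).getD []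

/-- The number of strands at the bottom of a local picture. -/
def LocalMove.width (M : LocalMove) : ℕ :=
  -- An empty side counts as 0, so the maximum takes the width from the nonempty side.
  max ((M.before.head?.map (·.bot.length)).getD 0) ((M.after.head?.map (·.bot.length)).getD 0)

/-- Perform a local move on the layers from number `i` on and to the right of the first `j`
strands, if this is possible. -/
def LocalMove.apply (M : LocalMove) (i j : ℕ) (D : List Layer) : Option (List Layer) :=
  let f := Layer.widen ((strandsAt D i).take j) ((strandsAt D i).drop (j + M.width))
  let D' := D.take i ++ M.after.map f ++ D.drop (i + M.before.length)
  if D = D.take i ++ M.before.map f ++ D.drop (i + M.before.length) ∧ IsTangle [] D' [] then some D'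
  else none

/-- Perform a sequence of local moves at given positions. -/
def applyMoves : List (ℕ × ℕ × LocalMove) → List Layer → Option (List Layer)
  | [], D => some D
  | (i, j, M) :: s, D => (M.apply i j D).bind (applyMoves s)

/-- The number of moves of type III in a sequence. -/
def countTypeIII (s : List (ℕ × ℕ × LocalMove)) : ℕ := s.countP (·.2.2.kind = .typeIII)

lemma Connects.applyMoves {s : List (ℕ × ℕ × LocalMove)} {m : ℕ} {E D D' : Diagram}
    (h : Connects m E D) (hs : applyMoves s D.layers = some D'.layers) :
    Connects (m + countTypeIII s) E D' := by
  induction s generalizing m D with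
  | nil =>
    obtain ⟨T, hT⟩ := D
    obtain ⟨T', hT'⟩ := D'
    cases hs
    exact h
  | cons t s ih =>
    obtain ⟨i, j, M⟩ := t
    obtain ⟨T, hT, hs⟩ := Option.bind_eq_some_iff.1 hs
    simp only [LocalMove.apply] at hT
    split_ifs at hT with hc
    cases hT
    -- The test in `LocalMove.apply` supplies both the decomposition demanded by `Move` and the
    -- closedness of the new diagram.
    have := ih (D := ⟨_, hc.2⟩) (h.step M.kind ⟨_, _, _, _, _, _, M.isLocal, hc.1, rfl⟩) hs
    convert this using 1
    by_cases hk : M.kind = .typeIII <;> simp [countTypeIII, hk] <;> ring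

lemma omega3_le_of_applyMoves {D D' : Diagram} (s : List (ℕ × ℕ × LocalMove))
    (hs : applyMoves s D.layers = some D'.layers) : Omega3 D D' ≤ countTypeIII s := by
  have h := (Connects.refl D).applyMoves hs
  rw [zero_add] at h
  exact iInf₂_le (f := fun m (_ : Connects m D D') => (m : ℕ∞)) _ h

open LocalMove

/-- In a row of crossings with the top crossing at height `i` and closed up on both sides, swing
the right closing arc to the left over the strands just below the top crossing. -/
def swingRightArc (i : ℕ) : List (ℕ × ℕ × LocalMove) :=
  [(i + 1, 0, forward (.exchange (.cap false) (.cap true) [])),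
    (i, 1, backward (.slideCap false true true)),
    (i + 1, 2, backward (.kinkRight true false)),
    (i + 3, 1, backward (.exchange (.cap true) (.cap false) [])),
    (i + 1, 2, forward (.slideCup true false false)),
    (i + 2, 1, backward (.exchange (.cap true) (.cross false true false) [])),
    (i + 1, 1, forward (.zigzagLeft true)),
    (i + 2, 0, backward (.bigon false false false)),
    (i + 3, 0, backward (.slideCap false false false)),
    (i + 4, 0, forward (.exchange (.cap false) (.cap false) [])),
    (i + 3, 1, backward (.slideCap true false true))]

/-- Move the arc over the crossing at height `i`. -/
def passCrossing (i : ℕ) : List (ℕ × ℕ × LocalMove) :=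
  [(i, 1, forward (.triangle true false false true true false (by decide))),
    (i + 2, 0, backward (.exchange (.cross false false false) (.cross true true true) []))]

/-- Move the arc over the minimum of the left closing arc and remove the last kink. -/
def passMinimum : List (ℕ × ℕ × LocalMove) :=
  [(1, 0, forward (.exchange (.cup false) (.cross false true false) [])),
    (2, 0, backward (.slideCup true false false)),
    (3, 0, forward (.bigon true false false)),
    (1, 0, backward (.zigzagLeft true)),
    (2, 0, forward (.exchange (.cap true) (.cross false true false) [])),
    (1, 1, backward (.slideCup true false false)),
    (0, 0, forward (.exchange (.cup true) (.cup false) [])),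
    (1, 0, forward (.kinkLeft true false))]

/-- Move the left closing arc of the long figure-eight knot to the right: swing it over the strands
just below the top crossing, then move it over the other three crossings and the minimum. -/
def passFigureEight : List (ℕ × ℕ × LocalMove) :=
  [(5, 1, forward (.slideCap true false false)),
    (6, 0, backward (.exchange (.cap true) (.cap false) [])),
    (5, 0, forward (.slideCap false true false)),
    (6, 2, backward (.kinkRight false false)),
    (8, 1, backward (.exchange (.cap true) (.cap false) [])),
    (6, 2, forward (.slideCup false false false)),
    (7, 1, backward (.exchange (.cap true) (.cross true true false) [])),
    (6, 1, forward (.zigzagLeft true)),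
    (7, 2, backward (.bigon true true true)),
    (8, 1, forward (.slideCap false false true)),
    (9, 0, backward (.exchange (.cap false) (.cap false) [])),
    (4, 0, backward (.exchange (.cross true true false) (.cross true true false) [])),
    (5, 1, backward (.triangle true true true true true false (by decide))),
    (3, 0, backward (.triangle true true false true true false (by decide))),
    (5, 0, forward (.exchange (.cross false true false) (.cross true true false) [])),
    (2, 0, backward (.exchange (.cross true true true) (.cross true false false) [])),
    (3, 1, backward (.triangle true true true true false false (by decide))),
    (1, 0, forward (.slideCup true true true)),
    (2, 1, forward (.bigon false false true)),
    (1, 0, forward (.exchange (.cup true) (.cross true true false) [])),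
    (1, 0, backward (.zigzagLeft true)),
    (2, 0, forward (.exchange (.cap true) (.cross true true false) [])),
    (1, 1, backward (.slideCup false false false)),
    (0, 0, forward (.exchange (.cup true) (.cup false) [])),
    (1, 0, forward (.kinkLeft false false))]

/-! ### Upper bounds, one type III move for each crossing below the top one -/

lemma omega3_D₁_D₂_le_two : Omega3 D₁ D₂ ≤ 2 :=
  omega3_le_of_applyMoves (swingRightArc 4 ++ passCrossing 3 ++ passCrossing 2 ++ passMinimum)
    (by decide +kernel)

lemma omega3_D₃_D₄_le_three : Omega3 D₃ D₄ ≤ 3 :=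
  omega3_le_of_applyMoves passFigureEight (by decide +kernel)

lemma omega3_D₅_D₆_le_three : Omega3 D₅ D₆ ≤ 3 :=
  omega3_le_of_applyMoves
    (swingRightArc 5 ++ passCrossing 4 ++ passCrossing 3 ++ passCrossing 2 ++ passMinimum)
    (by decide +kernel)

end PlaneDiagram

theorem theorem1p1 :
    PlaneDiagram.Omega3 PlaneDiagram.D₁ PlaneDiagram.D₂ = 2 ∧
    PlaneDiagram.Omega3 PlaneDiagram.D₃ PlaneDiagram.D₄ = 3 ∧
    PlaneDiagram.Omega3 PlaneDiagram.D₅ PlaneDiagram.D₆ = 3 :=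
  ⟨PlaneDiagram.omega3_D₁_D₂_le_two.antisymm PlaneDiagram.two_le_omega3_D₁_D₂,
    PlaneDiagram.omega3_D₃_D₄_le_three.antisymm PlaneDiagram.three_le_omega3_D₃_D₄,
    PlaneDiagram.omega3_D₅_D₆_le_three.antisymm PlaneDiagram.three_le_omega3_D₅_D₆⟩
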